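/- Let $W$ be a finitely generated Coxeter group. For an element $w\in W$ of finite order, let the finite continuation $\mathrm{FC}(w)$ be the intersection of all maximal finite subgroups of $W$ that contain $w$. Let $w\in W$ be an involution (an element of order $2$) such that $\mathrm{FC}(w)=\langle w\rangle$. Then for every subset $S\subseteq W$ such that $(W,S)$ is a Coxeter system, $w$ is conjugate in $W$ to an element of $S$. That is, $w$ is a reflection with respect to every Coxeter system structure on $W$. -/

import Mathlib

/-- `S ⊆ W` is a Coxeter generating set, i.e. `(W, S)` is a Coxeter system: for some Coxeter
matrix `M` indexed by `S` (an entry `0` of `M` stands for `∞`), the group `W` is presented by the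
generators `S` subject to the Coxeter relations of `M`, each generator being the corresponding
element of `W` itself. -/
def IsCoxeterGeneratingSet {W : Type*} [Group W] (S : Set W) : Prop :=
  ∃ (M : CoxeterMatrix S) (cs : CoxeterSystem M W), ∀ s : S, cs.simple s = (s : W)

/-- `F` is a maximal finite subgroup of `W`. -/
def IsMaximalFiniteSubgroup {W : Type*} [Group W] (F : Subgroup W) : Prop :=
  Maximal (fun H : Subgroup W => Finite H) F

/-- The finite continuation `FC(w)`: the intersection of all maximal finite subgroups of `W`
containing `w` (of interest when `w` has finite order). -/
def finiteContinuation {W : Type*} [Group W] (w : W) : Subgroup W :=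
  sInf {F : Subgroup W | IsMaximalFiniteSubgroup F ∧ w ∈ F}

/-!
For any Coxeter system on `W`, some reflection `t` lies in the finite continuation of a given
involution `w`. If that finite continuation is `{1, w}`, then `t = w`.

Both halves of the argument use the geometric representation `CoxeterSystem.geomRep` on `B →₀ ℝ`,
in which every root has either nonnegative or nonpositive coordinates
(`CoxeterSystem.geomRep_simpleRoot_nonneg`).

An involution `w` negates some root `β` (`CoxeterSystem.exists_geomRep_eq_neg`): among the
conjugates of `w` choose one of minimal length, and a simple reflection at which it descends; unless
this conjugate negates the simple root, conjugating by the simple reflection would shorten it.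

A maximal finite subgroup `F` is the full stabilizer of a linear form `x`
(`CoxeterSystem.exists_le_formStabilizer`). Summing the translates of a form positive on the simple
roots over `F` gives an `F`-invariant form `x` that is positive on all but finitely many positive
roots. The stabilizer of such a form is finite (`CoxeterSystem.finite_formStabilizer`): up to
conjugation `x` is nonnegative on the positive roots, and then its stabilizer acts faithfully on the
finite set of roots on which `x` vanishes. By maximality `F` is this stabilizer.

If now `w ∈ F`, then `x β = x (w β) = -x β`, so `x β = 0` and the reflection `t` in `β` fixes `x`,
that is, `t ∈ F`. As `t` does not depend on `F`, it lies in the finite continuation of `w`.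
-/

/-! ### The geometric representation -/

namespace CoxeterMatrix

open Polynomial.Chebyshev

variable {B : Type*} (M : CoxeterMatrix B)

/-- The simple coroot at `i`, the linear form `v ↦ 2 ⟨α i, v⟩` on the space `B →₀ ℝ` of the geometric
representation. Its value on the `j`-th basis vector is `-2 cos (π / M i j)`; the entry `M i j = 0`,
which stands for `∞`, gives the customary value `-2` since `π / 0 = 0`. -/
noncomputable def simpleCoroot (i : B) : Module.Dual ℝ (B →₀ ℝ) :=
  Finsupp.linearCombination ℝ fun j ↦ -(2 * Real.cos (Real.pi / M i j))

/-- The simple root at `i`: the `i`-th basis vector of `B →₀ ℝ`. -/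
noncomputable def simpleRoot (i : B) : B →₀ ℝ := Finsupp.single i 1

lemma simpleRoot_nonneg (i : B) : 0 ≤ simpleRoot i := by
  classical
  intro j
  simp only [simpleRoot, Finsupp.single_apply]
  split_ifs <;> simp

lemma simpleRoot_ne_zero (i : B) : simpleRoot i ≠ 0 := by
  simp [simpleRoot]

lemma simpleCoroot_simpleRoot (i j : B) :
    M.simpleCoroot i (simpleRoot j) = -(2 * Real.cos (Real.pi / M i j)) := by
  simp [simpleCoroot, simpleRoot]

lemma simpleCoroot_simpleRoot_self (i : B) : M.simpleCoroot i (simpleRoot i) = 2 := by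
  simp [simpleCoroot_simpleRoot]

lemma simpleCoroot_simpleRoot_comm (i j : B) :
    M.simpleCoroot i (simpleRoot j) = M.simpleCoroot j (simpleRoot i) := by
  rw [simpleCoroot_simpleRoot, simpleCoroot_simpleRoot, M.symmetric]

/-- The simple reflection `v ↦ v - 2 ⟨α i, v⟩ α i` of the geometric representation. -/
noncomputable def simpleReflection (i : B) : (B →₀ ℝ) ≃ₗ[ℝ] (B →₀ ℝ) :=
  Module.reflection (M.simpleCoroot_simpleRoot_self i)

lemma simpleReflection_apply (i : B) (v : B →₀ ℝ) :
    M.simpleReflection i v = v - M.simpleCoroot i v • simpleRoot i :=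
  Module.reflection_apply _ _

lemma simpleReflection_simpleRoot_self (i : B) :
    M.simpleReflection i (simpleRoot i) = -simpleRoot i :=
  Module.reflection_apply_self _

lemma simpleReflection_mul_self (i : B) : M.simpleReflection i * M.simpleReflection i = 1 :=
  LinearEquiv.ext (Module.involutive_reflection (M.simpleCoroot_simpleRoot_self i))

/-- The coefficients `sin (k θ) / sin θ`, for `θ = π / M i j`, of the roots in the plane spanned by
two simple roots. They are written through Chebyshev polynomials so that they equal `k` for
`M i j = 0`. -/
noncomputable def dihedralCoeff (i j : B) (k : ℕ) : ℝ :=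
  (S ℝ ((k : ℤ) - 1)).eval (2 * Real.cos (Real.pi / M i j))

lemma dihedralCoeff_zero (i j : B) : M.dihedralCoeff i j 0 = 0 := by
  simp [dihedralCoeff, S_neg_one]

lemma dihedralCoeff_one (i j : B) : M.dihedralCoeff i j 1 = 1 := by
  simp [dihedralCoeff]

lemma dihedralCoeff_add_two (i j : B) (k : ℕ) :
    M.dihedralCoeff i j (k + 2) =
      2 * Real.cos (Real.pi / M i j) * M.dihedralCoeff i j (k + 1) - M.dihedralCoeff i j k := by
  have h := congrArg (Polynomial.eval (2 * Real.cos (Real.pi / M i j))) (S_add_two ℝ ((k : ℤ) - 1))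
  simp only [Polynomial.eval_sub, Polynomial.eval_mul, Polynomial.eval_X] at h
  simp only [dihedralCoeff]
  push_cast
  convert h using 3
  all_goals first | rfl | (congr 2; ring)

lemma dihedralCoeff_mul_sin (i j : B) (k : ℕ) :
    M.dihedralCoeff i j k * Real.sin (Real.pi / M i j) = Real.sin (k * (Real.pi / M i j)) := by
  rw [dihedralCoeff, S_two_mul_real_cos]
  push_cast
  ring_nf

lemma sin_pi_div_pos {i j : B} (hij : i ≠ j) (h : M i j ≠ 0) :
    0 < Real.sin (Real.pi / M i j) := by
  have h1 := M.off_diagonal i j hij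
  have h2 : (2 : ℝ) ≤ M i j := by exact_mod_cast (by omega : 2 ≤ M i j)
  apply Real.sin_pos_of_pos_of_lt_pi (by have := Real.pi_pos; positivity)
  rw [div_lt_iff₀ (by linarith)]
  nlinarith [Real.pi_pos]

lemma dihedralCoeff_nonneg {i j : B} (hij : i ≠ j) {k : ℕ} (hk : M i j = 0 ∨ k ≤ M i j) :
    0 ≤ M.dihedralCoeff i j k := by
  by_cases h : M i j = 0
  · simp [dihedralCoeff, h]
  · have hs := M.sin_pi_div_pos hij h
    refine nonneg_of_mul_nonneg_left ?_ hs
    rw [dihedralCoeff_mul_sin]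
    have hM : (0 : ℝ) < M i j := by positivity
    have hk' : (k : ℝ) ≤ M i j := by exact_mod_cast hk.resolve_left h
    apply Real.sin_nonneg_of_nonneg_of_le_pi
    · have := Real.pi_pos
      positivity
    · rw [← mul_div_assoc, div_le_iff₀ hM, mul_comm]
      gcongr

lemma simpleReflection_mul_pow_apply (i j : B) (k : ℕ) :
    ((M.simpleReflection i * M.simpleReflection j) ^ k) (simpleRoot i) =
      M.dihedralCoeff i j (2 * k + 1) • simpleRoot i +
        M.dihedralCoeff i j (2 * k) • simpleRoot j := by
  induction k with
  | zero => simp [dihedralCoeff_zero, dihedralCoeff_one]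
  | succ k ih =>
    rw [pow_succ', LinearEquiv.mul_apply, ih, LinearEquiv.mul_apply]
    have h1 := M.dihedralCoeff_add_two i j (2 * k)
    have h2 := M.dihedralCoeff_add_two i j (2 * k + 1)
    rw [show 2 * (k + 1) + 1 = 2 * k + 1 + 2 by ring, show 2 * (k + 1) = 2 * k + 2 by ring, h2,
      show 2 * k + 1 + 1 = 2 * k + 2 by ring, h1]
    simp only [simpleReflection_apply, map_add, map_sub, map_smul, simpleCoroot_simpleRoot_self,
      M.simpleCoroot_simpleRoot_comm j i, M.simpleCoroot_simpleRoot i j]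
    match_scalars <;> ring

lemma simpleReflection_mul_pow_apply_left {i j : B} (hij : i ≠ j) (h : M i j ≠ 0) :
    ((M.simpleReflection i * M.simpleReflection j) ^ M i j) (simpleRoot i) = simpleRoot i := by
  have hs := M.sin_pi_div_pos hij h
  have hM : (M i j : ℝ) ≠ 0 := by exact_mod_cast h
  have h0 : M.dihedralCoeff i j (2 * M i j) = 0 := by
    apply mul_right_cancel₀ hs.ne'
    rw [dihedralCoeff_mul_sin]
    push_cast
    rw [show 2 * (M i j : ℝ) * (Real.pi / M i j) = 2 * Real.pi by field_simp]
    simp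
  have h1 : M.dihedralCoeff i j (2 * M i j + 1) = 1 := by
    apply mul_right_cancel₀ hs.ne'
    rw [dihedralCoeff_mul_sin]
    push_cast
    rw [show (2 * (M i j : ℝ) + 1) * (Real.pi / M i j) = Real.pi / M i j + 2 * Real.pi by
      field_simp; ring]
    simp
  rw [simpleReflection_mul_pow_apply, h0, h1]
  simp

/-- The simple reflections satisfy the Coxeter relations. The product of two of them fixes a
complement of the plane spanned by their roots, and has order `M i j` on this plane. -/
lemma isLiftable_simpleReflection : M.IsLiftable M.simpleReflection := by
  intro i j
  by_cases hij : i = j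
  · subst hij
    rw [simpleReflection_mul_self, one_pow]
  by_cases h : M i j = 0
  · rw [h, pow_zero]
  have hi := M.simpleReflection_mul_pow_apply_left hij h
  have hj : ((M.simpleReflection i * M.simpleReflection j) ^ M i j) (simpleRoot j) =
      simpleRoot j := by
    have h' := M.simpleReflection_mul_pow_apply_left (Ne.symm hij) (by rwa [M.symmetric])
    rw [M.symmetric j i] at h'
    have hinv : (M.simpleReflection i * M.simpleReflection j) ^ M i j *
        (M.simpleReflection j * M.simpleReflection i) ^ M i j = 1 := by
      rw [mul_eq_one_iff_eq_inv, ← inv_pow, mul_inv_rev,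
        inv_eq_of_mul_eq_one_right (M.simpleReflection_mul_self i),
        inv_eq_of_mul_eq_one_right (M.simpleReflection_mul_self j)]
    have := LinearEquiv.congr_fun hinv (simpleRoot j)
    rwa [LinearEquiv.mul_apply, h', LinearEquiv.coe_one, id] at this
  ext1 z
  set a := 2 * Real.cos (Real.pi / M i j) with ha
  have hdet : 4 - a ^ 2 ≠ 0 := by
    have := M.sin_pi_div_pos hij h
    rw [ha, show 4 - (2 * Real.cos (Real.pi / M i j)) ^ 2 = 4 * Real.sin (Real.pi / M i j) ^ 2 by
      rw [Real.sin_sq]; ring]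
    positivity
  -- The pair `(p, q)` solves the linear system `simpleCoroot i y = simpleCoroot j y = 0`
  -- for `y = z - p • simpleRoot i - q • simpleRoot j`.
  set p := (2 * M.simpleCoroot i z + a * M.simpleCoroot j z) / (4 - a ^ 2) with hp
  set q := (2 * M.simpleCoroot j z + a * M.simpleCoroot i z) / (4 - a ^ 2) with hq
  obtain ⟨y, hy⟩ : ∃ y, y = z - p • simpleRoot i - q • simpleRoot j := ⟨_, rfl⟩
  have hyi : M.simpleReflection i y = y := by
    have : M.simpleCoroot i y = 0 := by
      simp only [hy, map_sub, map_smul, simpleCoroot_simpleRoot_self, M.simpleCoroot_simpleRoot i j,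
        ← ha, smul_eq_mul, hp, hq]
      field_simp
      ring
    rw [simpleReflection_apply, this]
    simp
  have hyj : M.simpleReflection j y = y := by
    have : M.simpleCoroot j y = 0 := by
      simp only [hy, map_sub, map_smul, simpleCoroot_simpleRoot_self,
        M.simpleCoroot_simpleRoot_comm j i, M.simpleCoroot_simpleRoot i j,
        ← ha, smul_eq_mul, hp, hq]
      field_simp
      ring
    rw [simpleReflection_apply, this]
    simp
  have hyp (k : ℕ) : ((M.simpleReflection i * M.simpleReflection j) ^ k) y = y := by
    induction k with
    | zero => simp
    | succ k ih => rw [pow_succ, LinearEquiv.mul_apply, LinearEquiv.mul_apply, hyj, hyi, ih]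
  have hz : z = y + p • simpleRoot i + q • simpleRoot j := by
    rw [hy]
    module
  rw [hz, map_add, map_add, map_smul, map_smul, hi, hj, hyp]
  simp

/-- The symmetric bilinear form `2 ⟨u, v⟩` preserved by the geometric representation, normalized so
that a simple root has square `2`. -/
noncomputable def rootForm : (B →₀ ℝ) →ₗ[ℝ] Module.Dual ℝ (B →₀ ℝ) :=
  Finsupp.linearCombination ℝ M.simpleCoroot

lemma rootForm_simpleRoot (i : B) : M.rootForm (simpleRoot i) = M.simpleCoroot i := by
  simp [rootForm, simpleRoot]

lemma rootForm_apply_simpleRoot (i : B) (v : B →₀ ℝ) :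
    M.rootForm v (simpleRoot i) = M.simpleCoroot i v := by
  suffices M.rootForm.flip (simpleRoot i) = M.simpleCoroot i from LinearMap.congr_fun this v
  refine Finsupp.lhom_ext' fun j ↦ LinearMap.ext_ring ?_
  change M.rootForm (simpleRoot j) (simpleRoot i) = M.simpleCoroot i (simpleRoot j)
  rw [rootForm_simpleRoot, simpleCoroot_simpleRoot_comm]

lemma rootForm_simpleReflection (i : B) (u v : B →₀ ℝ) :
    M.rootForm (M.simpleReflection i u) (M.simpleReflection i v) = M.rootForm u v := by
  simp only [simpleReflection_apply, map_sub, map_smul, LinearMap.sub_apply, LinearMap.smul_apply,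
    rootForm_apply_simpleRoot, rootForm_simpleRoot, simpleCoroot_simpleRoot_self, smul_eq_mul]
  ring

end CoxeterMatrix

namespace CoxeterSystem

open CoxeterMatrix

variable {B W : Type*} [Group W] {M : CoxeterMatrix B} (cs : CoxeterSystem M W)

/-- The geometric representation of a Coxeter group on `B →₀ ℝ`. -/
noncomputable def geomRep : W →* ((B →₀ ℝ) ≃ₗ[ℝ] (B →₀ ℝ)) :=
  cs.lift ⟨M.simpleReflection, M.isLiftable_simpleReflection⟩

lemma geomRep_simple (i : B) : cs.geomRep (cs.simple i) = M.simpleReflection i :=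
  cs.lift_apply_simple M.isLiftable_simpleReflection i

lemma geomRep_mul_apply (u v : W) (x : B →₀ ℝ) :
    cs.geomRep (u * v) x = cs.geomRep u (cs.geomRep v x) := by
  rw [map_mul, LinearEquiv.mul_apply]

lemma geomRep_mul_simple_simpleRoot (w : W) (i : B) :
    cs.geomRep (w * cs.simple i) (simpleRoot i) = -cs.geomRep w (simpleRoot i) := by
  rw [geomRep_mul_apply, geomRep_simple, simpleReflection_simpleRoot_self, map_neg]

lemma rootForm_geomRep (w : W) (u v : B →₀ ℝ) :
    M.rootForm (cs.geomRep w u) (cs.geomRep w v) = M.rootForm u v := by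
  induction w using cs.simple_induction_left with
  | one => simp
  | mul_simple_left w i ih =>
    rw [geomRep_mul_apply, geomRep_mul_apply, geomRep_simple, rootForm_simpleReflection, ih]

/-- The action on `α i` of an alternating word that ends with `j`; the letter to be put in front of
such a word of length `k` is `j` for `k` even and `i` for `k` odd. -/
lemma geomRep_alternatingWord (i j : B) (k : ℕ) :
    cs.geomRep (cs.wordProd (alternatingWord i j k)) (simpleRoot i) =
      M.dihedralCoeff i j (if Even k then k + 1 else k) • simpleRoot i +
        M.dihedralCoeff i j (if Even k then k else k + 1) • simpleRoot j := by
  induction k with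
  | zero => simp [alternatingWord, dihedralCoeff_zero, dihedralCoeff_one]
  | succ k ih =>
    rw [alternatingWord_succ', wordProd_cons, geomRep_mul_apply, ih, geomRep_simple]
    have h := M.dihedralCoeff_add_two i j k
    by_cases hk : Even k
    · simp only [hk, Nat.even_add_one, if_true, not_true_eq_false, if_false,
        show k + 1 + 1 = k + 2 from rfl, h]
      simp only [simpleReflection_apply, map_add, map_smul, simpleCoroot_simpleRoot_self,
        M.simpleCoroot_simpleRoot_comm j i, M.simpleCoroot_simpleRoot i j]
      match_scalars <;> ring
    · simp only [hk, Nat.even_add_one, if_true, not_false_eq_true, if_false,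
        show k + 1 + 1 = k + 2 from rfl, h]
      simp only [simpleReflection_apply, map_add, map_smul, simpleCoroot_simpleRoot_self,
        M.simpleCoroot_simpleRoot i j]
      match_scalars <;> ring

/-! ### Positive and negative roots -/

/-- If `ℓ (w * s i) > ℓ w`, then `w` maps `α i` to a vector with nonnegative coordinates. In a
factorization `w = v * u` with `u` a longest possible alternating word in `i` and `j`, the root
`u (α i)` is a nonnegative combination of `α i` and `α j`, and by induction the shorter element `v`
maps both of these to vectors with nonnegative coordinates. -/
theorem geomRep_simpleRoot_nonneg {w : W} {i : B} (h : ¬cs.IsRightDescent w i) :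
    0 ≤ cs.geomRep w (simpleRoot i) := by
  classical
  induction hn : cs.length w using Nat.strong_induction_on generalizing w i with
  | _ n ih =>
  subst hn
  by_cases hw : w = 1
  · simpa [hw] using simpleRoot_nonneg i
  obtain ⟨j, hj⟩ := cs.exists_rightDescent_of_ne_one hw
  have hij : i ≠ j := by
    rintro rfl
    exact h hj
  -- A longest alternating word in `i` and `j`, ending with `j`, that is split off `w` on the right.
  let P : ℕ → Prop := fun k ↦
    ∃ v, w = v * cs.wordProd (alternatingWord i j k) ∧ cs.length w = cs.length v + k
  have hP1 : P 1 := ⟨w * cs.simple j, by simp [alternatingWord],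
    (cs.isRightDescent_iff.1 hj).symm⟩
  have hlen : 1 ≤ cs.length w := by
    obtain ⟨v, -, hv⟩ := hP1
    omega
  obtain ⟨k, hk⟩ : ∃ k, k = Nat.findGreatest P (cs.length w) := ⟨_, rfl⟩
  have hPk : P k := hk ▸ Nat.findGreatest_spec hlen hP1
  have hk1 : 1 ≤ k := hk ▸ Nat.le_findGreatest hlen hP1
  have hmax : ¬P (k + 1) := by
    intro hP
    have hle : k + 1 ≤ cs.length w := by
      obtain ⟨v, -, hv⟩ := hP
      omega
    have := Nat.le_findGreatest hle hP
    omega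
  obtain ⟨v, hwv, hlv⟩ := hPk
  -- The coset representative `v` is descended neither by the next letter of the alternating word,
  -- since `k` is maximal, nor by its first letter, since the lengths add up.
  have hnext : ¬cs.IsRightDescent v (if Even k then j else i) := by
    intro hd
    have := cs.isRightDescent_iff.1 hd
    refine hmax ⟨v * cs.simple (if Even k then j else i), ?_, by omega⟩
    rw [alternatingWord_succ', wordProd_cons, mul_assoc, simple_mul_simple_cancel_left, hwv]
  have hfirst : ¬cs.IsRightDescent v (if Even k then i else j) := by
    intro hd
    have h1 := cs.isRightDescent_iff.1 hd
    obtain ⟨l, rfl⟩ := Nat.exists_eq_add_of_le' hk1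
    rw [alternatingWord_succ', wordProd_cons, ← mul_assoc] at hwv
    have hl : (if Even (l + 1) then i else j) = if Even l then j else i := by
      by_cases hl : Even l <;> simp [hl, Nat.even_add_one]
    rw [hl] at h1
    have h2 := cs.length_mul_le (v * cs.simple (if Even l then j else i))
      (cs.wordProd (alternatingWord i j l))
    have h3 := cs.length_wordProd_le (alternatingWord i j l)
    rw [length_alternatingWord] at h3
    rw [← hwv] at h2
    omega
  have hvi : ¬cs.IsRightDescent v i := by
    by_cases he : Even k
    · simpa [he] using hfirst
    · simpa [he] using hnext
  have hvj : ¬cs.IsRightDescent v j := by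
    by_cases he : Even k
    · simpa [he] using hnext
    · simpa [he] using hfirst
  -- By the braid relation a word of length `M i j` could be made to end with `i`.
  have hkM : M i j = 0 ∨ k + 1 ≤ M i j := by
    by_contra! hcon
    obtain ⟨hM0, hMk⟩ := hcon
    rcases (Nat.lt_succ_iff.1 hMk).lt_or_eq with hlt | heq
    · have h1 := cs.not_isReduced_alternatingWord i j hM0 hlt
      have h2 := cs.length_wordProd_le (alternatingWord i j k)
      have h3 := cs.length_mul_le v (cs.wordProd (alternatingWord i j k))
      rw [← hwv] at h3
      rw [IsReduced, length_alternatingWord] at h1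
      rw [length_alternatingWord] at h2
      omega
    · have hb := cs.wordProd_braidWord_eq i j
      rw [braidWord, braidWord, M.symmetric j i, heq] at hb
      obtain ⟨l, rfl⟩ := Nat.exists_eq_add_of_le' hk1
      rw [hb, alternatingWord_succ, wordProd_concat, ← mul_assoc] at hwv
      have h1 := cs.length_mul_le v (cs.wordProd (alternatingWord i j l))
      have h2 := cs.length_wordProd_le (alternatingWord i j l)
      rw [length_alternatingWord] at h2
      apply h
      rw [IsRightDescent]
      have h3 : w * cs.simple i = v * cs.wordProd (alternatingWord i j l) := by
        rw [hwv, simple_mul_simple_cancel_right]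
      rw [h3]
      omega
  have hrv : ∀ u, ¬cs.IsRightDescent v u → 0 ≤ cs.geomRep v (simpleRoot u) :=
    fun u hu ↦ ih _ (by omega) hu rfl
  rw [hwv, geomRep_mul_apply, geomRep_alternatingWord, map_add, map_smul, map_smul]
  refine add_nonneg (smul_nonneg (M.dihedralCoeff_nonneg hij ?_) (hrv i hvi))
    (smul_nonneg (M.dihedralCoeff_nonneg hij ?_) (hrv j hvj)) <;>
  · split_ifs <;> omega

theorem geomRep_simpleRoot_nonpos {w : W} {i : B} (h : cs.IsRightDescent w i) :
    cs.geomRep w (simpleRoot i) ≤ 0 := by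
  have := cs.geomRep_simpleRoot_nonneg (cs.isRightDescent_iff_not_isRightDescent_mul.1 h)
  rwa [geomRep_mul_simple_simpleRoot, Left.nonneg_neg_iff] at this

lemma geomRep_simpleRoot_ne_zero (w : W) (i : B) : cs.geomRep w (simpleRoot i) ≠ 0 := by
  simp [simpleRoot_ne_zero]

lemma isRightDescent_of_geomRep_simpleRoot_nonpos {w : W} {i : B}
    (h : cs.geomRep w (simpleRoot i) ≤ 0) : cs.IsRightDescent w i := by
  by_contra hd
  exact cs.geomRep_simpleRoot_ne_zero w i (le_antisymm h (cs.geomRep_simpleRoot_nonneg hd))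

/-- The roots of the geometric representation: the images of the simple roots. -/
def IsRoot (β : B →₀ ℝ) : Prop := ∃ w i, β = cs.geomRep w (simpleRoot i)

/-- The positive roots: those with nonnegative coordinates. -/
def posRoots : Set (B →₀ ℝ) := {β | cs.IsRoot β ∧ 0 ≤ β}

lemma isRoot_simpleRoot (i : B) : cs.IsRoot (simpleRoot i) := ⟨1, i, by simp⟩

lemma simpleRoot_mem_posRoots (i : B) : simpleRoot i ∈ cs.posRoots :=
  ⟨cs.isRoot_simpleRoot i, simpleRoot_nonneg i⟩

variable {cs}

lemma IsRoot.geomRep {β : B →₀ ℝ} (h : cs.IsRoot β) (u : W) : cs.IsRoot (cs.geomRep u β) := by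
  obtain ⟨w, i, rfl⟩ := h
  exact ⟨u * w, i, by rw [geomRep_mul_apply]⟩

lemma IsRoot.simpleReflection {β : B →₀ ℝ} (h : cs.IsRoot β) (i : B) :
    cs.IsRoot (M.simpleReflection i β) := by
  simpa [geomRep_simple] using h.geomRep (cs.simple i)

lemma IsRoot.neg {β : B →₀ ℝ} (h : cs.IsRoot β) : cs.IsRoot (-β) := by
  obtain ⟨w, i, rfl⟩ := h
  exact ⟨w * cs.simple i, i, by rw [geomRep_mul_simple_simpleRoot]⟩

lemma IsRoot.ne_zero {β : B →₀ ℝ} (h : cs.IsRoot β) : β ≠ 0 := by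
  obtain ⟨w, i, rfl⟩ := h
  exact cs.geomRep_simpleRoot_ne_zero w i

lemma IsRoot.nonneg_or_nonpos {β : B →₀ ℝ} (h : cs.IsRoot β) : 0 ≤ β ∨ β ≤ 0 := by
  obtain ⟨w, i, rfl⟩ := h
  by_cases hd : cs.IsRightDescent w i
  · exact Or.inr (cs.geomRep_simpleRoot_nonpos hd)
  · exact Or.inl (cs.geomRep_simpleRoot_nonneg hd)

lemma IsRoot.rootForm_self {β : B →₀ ℝ} (h : cs.IsRoot β) : M.rootForm β β = 2 := by
  obtain ⟨w, i, rfl⟩ := h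
  rw [rootForm_geomRep, rootForm_simpleRoot, simpleCoroot_simpleRoot_self]

/-- A simple reflection permutes the positive roots other than its own simple root: it changes only
one coordinate, and such a root has a positive coordinate elsewhere. -/
lemma simpleReflection_mem_posRoots {β : B →₀ ℝ} (h : β ∈ cs.posRoots) {i : B}
    (hi : β ≠ simpleRoot i) : M.simpleReflection i β ∈ cs.posRoots := by
  classical
  have hroot := h.1.simpleReflection i
  refine ⟨hroot, hroot.nonneg_or_nonpos.resolve_right fun hneg ↦ hi ?_⟩
  have hcoord : ∀ j, j ≠ i → β j = 0 := by
    intro j hj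
    have h1 : β j ≤ 0 := by
      simpa [simpleReflection_apply, simpleRoot, Finsupp.single_apply, hj.symm] using hneg j
    exact le_antisymm h1 (h.2 j)
  have hβ : β = β i • simpleRoot i := by
    ext j
    by_cases hj : j = i
    · subst hj
      simp [simpleRoot]
    · simp [simpleRoot, hj, hcoord j hj]
  have hnorm := h.1.rootForm_self
  rw [hβ, map_smul, map_smul, LinearMap.smul_apply, rootForm_simpleRoot,
    simpleCoroot_simpleRoot_self, smul_eq_mul, smul_eq_mul] at hnorm
  have h0 : 0 ≤ β i := h.2 i
  have h1 : β i = 1 := by nlinarith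
  rw [hβ, h1, one_smul]

variable (cs)

lemma finite_posRoots_inversions (w : W) :
    {β ∈ cs.posRoots | cs.geomRep w β ≤ 0}.Finite := by
  induction w using cs.simple_induction_right with
  | one =>
    convert Set.finite_empty
    refine Set.eq_empty_of_forall_notMem fun β hβ ↦ hβ.1.1.ne_zero (le_antisymm ?_ hβ.1.2)
    simpa using hβ.2
  | mul_simple_right w i ih =>
    refine ((ih.image (M.simpleReflection i)).insert (simpleRoot i)).subset ?_
    rintro β ⟨hβ, hneg⟩
    rw [geomRep_mul_apply, geomRep_simple] at hneg
    by_cases hi : β = simpleRoot i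
    · exact Or.inl hi
    · refine Or.inr ⟨_, ⟨simpleReflection_mem_posRoots hβ hi, hneg⟩, ?_⟩
      exact Module.involutive_reflection (M.simpleCoroot_simpleRoot_self i) β

/-! ### Stabilizers of linear forms and finite subgroups -/

/-- The stabilizer of a linear form under the dual of the geometric representation. -/
def formStabilizer (x : Module.Dual ℝ (B →₀ ℝ)) : Subgroup W where
  carrier := {u | ∀ v, x (cs.geomRep u v) = x v}
  one_mem' := by simp
  mul_mem' {a b} ha hb v := by rw [geomRep_mul_apply, ha, hb]
  inv_mem' {a} ha v := by rw [← ha, ← geomRep_mul_apply]; simp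

/-- The stabilizer of a dominant form acts faithfully on the roots on which the form vanishes:
if `u ≠ 1` fixes `x` and descends at `i`, then `x (α i) = x (u (α i)) ≤ 0`, so that `α i` is such a
root, and `u` moves it. -/
lemma finite_formStabilizer_of_dominant {x : Module.Dual ℝ (B →₀ ℝ)}
    (hdom : ∀ i, 0 ≤ x (simpleRoot i)) (hfin : {β ∈ cs.posRoots | x β ≤ 0}.Finite) :
    Finite (cs.formStabilizer x) := by
  have hnonneg : ∀ v : B →₀ ℝ, 0 ≤ v → 0 ≤ x v := by
    intro v hv
    rw [← Finsupp.sum_single v, Finsupp.sum, map_sum]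
    refine Finset.sum_nonneg fun j _ ↦ ?_
    have : Finsupp.single j (v j) = v j • simpleRoot j := by simp [simpleRoot]
    rw [this, map_smul]
    exact mul_nonneg (hv j) (hdom j)
  let Z : Set (B →₀ ℝ) := {β | cs.IsRoot β ∧ x β = 0}
  have hZ : Z.Finite := by
    refine (hfin.union hfin.neg).subset ?_
    rintro β ⟨hβ, hx⟩
    rcases hβ.nonneg_or_nonpos with h | h
    · exact Or.inl ⟨⟨hβ, h⟩, hx.le⟩
    · exact Or.inr ⟨⟨hβ.neg, by simpa using h⟩, by simp [hx]⟩
  have : Finite Z := hZ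
  let f : cs.formStabilizer x → Z → Z := fun u β ↦
    ⟨cs.geomRep u β, β.2.1.geomRep u, (u.2 β).trans β.2.2⟩
  refine Finite.of_injective f fun u v huv ↦ ?_
  by_contra hne
  have hne' : (v : W)⁻¹ * u ≠ 1 := by
    rw [ne_eq, inv_mul_eq_one]
    exact fun h ↦ hne (Subtype.ext h.symm)
  obtain ⟨i, hi⟩ := cs.exists_rightDescent_of_ne_one hne'
  have hneg := cs.geomRep_simpleRoot_nonpos hi
  have hx0 : x (simpleRoot i) = 0 := by
    refine le_antisymm ?_ (hdom i)
    have h1 := hnonneg _ (neg_nonneg.2 hneg)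
    rw [map_neg, (mul_mem (inv_mem v.2) u.2 : (v : W)⁻¹ * u ∈ cs.formStabilizer x)] at h1
    linarith
  have hfix := congrArg Subtype.val (congrFun huv ⟨simpleRoot i, cs.isRoot_simpleRoot i, hx0⟩)
  simp only [f] at hfix
  rw [geomRep_mul_apply, hfix, ← geomRep_mul_apply, inv_mul_cancel, map_one,
    LinearEquiv.coe_one, id] at hneg
  exact simpleRoot_ne_zero i (le_antisymm hneg (simpleRoot_nonneg i))

/-- A form that is positive on all but finitely many positive roots has a finite stabilizer:
while it is negative on a simple root, applying the simple reflection makes it negative on fewer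
positive roots, so that it is in the orbit of a dominant form. -/
theorem finite_formStabilizer {x : Module.Dual ℝ (B →₀ ℝ)}
    (hfin : {β ∈ cs.posRoots | x β ≤ 0}.Finite) : Finite (cs.formStabilizer x) := by
  induction hn : {β ∈ cs.posRoots | x β < 0}.ncard using Nat.strong_induction_on
    generalizing x with
  | _ n ih =>
  by_cases hdom : ∀ i, 0 ≤ x (simpleRoot i)
  · exact cs.finite_formStabilizer_of_dominant hdom hfin
  push Not at hdom
  obtain ⟨i, hi⟩ := hdom
  let y : Module.Dual ℝ (B →₀ ℝ) := x ∘ₗ (M.simpleReflection i).toLinearMap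
  have hy (v) : y v = x (M.simpleReflection i v) := rfl
  have hinv : Function.Involutive (M.simpleReflection i) :=
    Module.involutive_reflection (M.simpleCoroot_simpleRoot_self i)
  have hyfin : {β ∈ cs.posRoots | y β ≤ 0}.Finite := by
    refine ((hfin.image (M.simpleReflection i)).insert (simpleRoot i)).subset ?_
    rintro β ⟨hβ, hneg⟩
    by_cases hβi : β = simpleRoot i
    · exact Or.inl hβi
    · exact Or.inr ⟨_, ⟨simpleReflection_mem_posRoots hβ hβi, hneg⟩, hinv β⟩
  have hlt : {β ∈ cs.posRoots | y β < 0}.ncard < n := by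
    have hfin' : {β ∈ cs.posRoots | x β < 0}.Finite := hfin.subset fun β hβ ↦ ⟨hβ.1, hβ.2.le⟩
    rw [← hn, ← Set.ncard_image_of_injective _ (M.simpleReflection i).injective]
    refine Set.ncard_lt_ncard ⟨?_, fun hsub ↦ ?_⟩ hfin'
    · rintro _ ⟨β, ⟨hβ, hneg⟩, rfl⟩
      refine ⟨simpleReflection_mem_posRoots hβ ?_, hneg⟩
      rintro rfl
      rw [hy, simpleReflection_simpleRoot_self, map_neg] at hneg
      linarith
    · obtain ⟨β, ⟨hβ, -⟩, hβi⟩ := hsub ⟨cs.simpleRoot_mem_posRoots i, hi⟩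
      have h1 : β = -simpleRoot i := by
        rw [← hinv β, hβi, simpleReflection_simpleRoot_self]
      have h2 : simpleRoot i ≤ 0 := by
        have := hβ.2
        rwa [h1, Left.nonneg_neg_iff] at this
      exact simpleRoot_ne_zero i (le_antisymm h2 (simpleRoot_nonneg i))
  have hfinY := ih _ hlt hyfin rfl
  let f : cs.formStabilizer x → cs.formStabilizer y := fun u ↦
    ⟨cs.simple i * u * cs.simple i, fun v ↦ by
      rw [hy, hy, geomRep_mul_apply, geomRep_mul_apply, geomRep_simple, hinv]
      exact u.2 _⟩
  refine Finite.of_injective f fun u v huv ↦ Subtype.ext ?_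
  exact mul_left_cancel (mul_right_cancel (congrArg Subtype.val huv))

/-- Every finite subgroup fixes a form with finite stabilizer: the sum, over the subgroup, of the
translates of the sum of coordinates. It is positive on every positive root that no element of the
subgroup makes negative. -/
theorem exists_le_formStabilizer (F : Subgroup W) [Finite F] :
    ∃ x, F ≤ cs.formStabilizer x ∧ Finite (cs.formStabilizer x) := by
  cases nonempty_fintype F
  let ht : Module.Dual ℝ (B →₀ ℝ) := Finsupp.linearCombination ℝ fun _ ↦ (1 : ℝ)
  have ht_pos {v : B →₀ ℝ} (hv : 0 ≤ v) (hv0 : v ≠ 0) : 0 < ht v := by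
    have hs : ht v = ∑ j ∈ v.support, v j := by
      simp [ht, Finsupp.linearCombination_apply, Finsupp.sum]
    rw [hs]
    refine Finset.sum_pos (fun j hj ↦ ?_) (Finsupp.support_nonempty_iff.2 hv0)
    exact lt_of_le_of_ne (hv j) (Finsupp.mem_support_iff.1 hj).symm
  let x : Module.Dual ℝ (B →₀ ℝ) := ∑ f : F, ht ∘ₗ (cs.geomRep f).toLinearMap
  have hx (v) : x v = ∑ f : F, ht (cs.geomRep f v) := by simp [x]
  refine ⟨x, fun u hu v ↦ ?_, cs.finite_formStabilizer ?_⟩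
  · rw [hx, hx]
    refine Fintype.sum_equiv (Equiv.mulRight (⟨u, hu⟩ : F)) _ _ fun f ↦ ?_
    rw [Equiv.coe_mulRight, Subgroup.coe_mul, geomRep_mul_apply]
  · refine (Set.finite_iUnion fun f : F ↦ cs.finite_posRoots_inversions (f : W)).subset ?_
    rintro β ⟨hβ, hneg⟩
    by_contra hnot
    simp only [Set.mem_iUnion, not_exists] at hnot
    refine absurd hneg (not_le.2 ?_)
    rw [hx]
    refine Finset.sum_pos (fun f _ ↦ ?_) Finset.univ_nonempty
    have hr := hβ.1.geomRep (f : W)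
    exact ht_pos (hr.nonneg_or_nonpos.resolve_right fun h ↦ hnot f ⟨hβ, h⟩) hr.ne_zero

/-! ### Involutions -/

/-- Every involution maps some root to its negative. In an involution `w` that descends at `i` and
does not negate `α i`, conjugation by the simple reflection at `i` shortens `w`. -/
theorem exists_geomRep_eq_neg {w : W} (hw : w * w = 1) (hw1 : w ≠ 1) :
    ∃ g i, cs.geomRep w (cs.geomRep g (simpleRoot i)) = -cs.geomRep g (simpleRoot i) := by
  induction hn : cs.length w using Nat.strong_induction_on generalizing w with
  | _ n ih =>
  subst hn
  obtain ⟨i, hi⟩ := cs.exists_rightDescent_of_ne_one hw1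
  by_cases hneg : cs.geomRep w (simpleRoot i) = -simpleRoot i
  · exact ⟨1, i, by simpa using hneg⟩
  have hpos : -cs.geomRep w (simpleRoot i) ∈ cs.posRoots :=
    ⟨((cs.isRoot_simpleRoot i).geomRep w).neg, neg_nonneg.2 (cs.geomRep_simpleRoot_nonpos hi)⟩
  have hpos' := simpleReflection_mem_posRoots hpos (i := i) fun h ↦ hneg (neg_eq_iff_eq_neg.1 h)
  have hdesc : cs.IsRightDescent (cs.simple i * w) i := by
    apply cs.isRightDescent_of_geomRep_simpleRoot_nonpos
    rw [geomRep_mul_apply, geomRep_simple]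
    simpa using hpos'.2
  have hwinv : w⁻¹ = w := inv_eq_of_mul_eq_one_right hw
  have hlen : cs.length (cs.simple i * w) < cs.length w := by
    have := (cs.isRightDescent_iff.1 hi)
    rw [← cs.length_inv (cs.simple i * w), mul_inv_rev, hwinv, inv_simple]
    omega
  have hconj : cs.simple i * w * cs.simple i * (cs.simple i * w * cs.simple i) = 1 := by
    rw [← mul_assoc, ← mul_assoc, simple_mul_simple_cancel_right, mul_assoc _ w w, hw, mul_one,
      simple_mul_simple_self]
  have hconj1 : cs.simple i * w * cs.simple i ≠ 1 := by
    intro h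
    have := congrArg (fun u ↦ cs.simple i * u * cs.simple i) h
    exact hw1 (by simpa [mul_assoc] using this)
  obtain ⟨g, j, hg⟩ := ih _ (lt_trans hdesc hlen) hconj hconj1 rfl
  refine ⟨cs.simple i * g, j, ?_⟩
  have := congrArg (cs.geomRep (cs.simple i)) hg
  simpa only [← geomRep_mul_apply, map_neg, mul_assoc, simple_mul_simple_cancel_left] using this

/-- If an involution `w` negates the root `β`, then the reflection in `β` lies in every maximal
finite subgroup containing `w`: such a subgroup is the stabilizer of a form `x`, and
`x β = x (w β) = -x β` vanishes. -/
theorem exists_isReflection_mem_finiteContinuation {w : W} (hw : w * w = 1) (hw1 : w ≠ 1) :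
    ∃ t, cs.IsReflection t ∧ t ∈ finiteContinuation w := by
  obtain ⟨g, i, hg⟩ := cs.exists_geomRep_eq_neg hw hw1
  refine ⟨g * cs.simple i * g⁻¹, ⟨g, i, rfl⟩, Subgroup.mem_sInf.2 ?_⟩
  rintro F ⟨hF, hwF⟩
  have := hF.prop
  obtain ⟨x, hFx, hfin⟩ := cs.exists_le_formStabilizer F
  refine hF.le_of_ge hfin hFx fun v ↦ ?_
  have hx0 : x (cs.geomRep g (simpleRoot i)) = 0 := by
    have := hFx hwF (cs.geomRep g (simpleRoot i))
    rw [hg, map_neg] at this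
    linarith
  rw [geomRep_mul_apply, geomRep_mul_apply, geomRep_simple, simpleReflection_apply, map_sub,
    map_smul, map_sub, map_smul, hx0, ← geomRep_mul_apply]
  simp

theorem isReflection_of_finiteContinuation_eq_zpowers {w : W} (hw : orderOf w = 2)
    (hFC : finiteContinuation w = Subgroup.zpowers w) : cs.IsReflection w := by
  have hw1 : w ≠ 1 := by
    rintro rfl
    simp at hw
  have hww : w ^ 2 = 1 := hw ▸ pow_orderOf_eq_one w
  obtain ⟨t, ht, htF⟩ := cs.exists_isReflection_mem_finiteContinuation (by rwa [← pow_two]) hw1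
  obtain ⟨k, rfl⟩ := Subgroup.mem_zpowers_iff.1 (hFC ▸ htF)
  have hw2 : w ^ (2 : ℤ) = 1 := by exact_mod_cast hww
  rcases Int.even_or_odd' k with ⟨m, rfl | rfl⟩
  · rw [zpow_mul, hw2, one_zpow] at ht
    simpa using ht.odd_length
  · rwa [zpow_add, zpow_mul, hw2, one_zpow, one_mul, zpow_one] at ht

end CoxeterSystem

theorem corollary3p10 {W : Type*} [Group W] [IsCoxeterGroup W] [Group.FG W]
    (w : W) (hw : orderOf w = 2) (hFC : finiteContinuation w = Subgroup.zpowers w) :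
    (∀ S : Set W, IsCoxeterGeneratingSet S → ∃ s ∈ S, IsConj s w) ∧
      (∀ (B : Type*) (M : CoxeterMatrix B) (cs : CoxeterSystem M W), cs.IsReflection w) := by
  refine ⟨fun S ⟨M, cs, hcs⟩ ↦ ?_, fun B M cs ↦
    cs.isReflection_of_finiteContinuation_eq_zpowers hw hFC⟩
  obtain ⟨g, s, rfl⟩ := cs.isReflection_of_finiteContinuation_eq_zpowers hw hFC
  exact ⟨s, s.2, isConj_iff.2 ⟨g, by rw [hcs]⟩⟩
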